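/- Let $d$ and $k$ be integers with $1\le k\le d-1$. There are constants $C,c>0$, depending only on $d$ and $k$, such that the following holds for every $d$-dimensional lattice $\Lambda\subset\mathbb{R}^d$ (the set of all integer linear combinations of $d$ linearly independent vectors) and every compact convex body $K\subset\mathbb{R}^d$ with non-empty interior and $K=-K$. For $1\le i\le d$ let $\lambda_i=\inf\{\lambda\ge 0:\dim(\Lambda\cap\lambda K)\ge i\}$ be the $i$-th successive minimum of $\Lambda$ and $K$, where $\dim(X)$ denotes the dimension of the affine hull of $X$. If $\lambda_d\le 1$, then $\Lambda\cap K$ can be covered by at most $C\,(\lambda_{k+1}\cdots\lambda_d)^{-1}$ $k$-dimensional affine subspaces of $\mathbb{R}^d$. On the other hand (whether or not $\lambda_d\le 1$), every collection of $k$-dimensional affine subspaces of $\mathbb{R}^d$ that covers $\Lambda\cap K$ has at least $c\,(\lambda_{k+1}\cdots\lambda_d)^{-1}$ members. -/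

import Mathlib

open scoped Pointwise

/-- The dimension of a set `X ⊆ ℝ^d`: the dimension of its affine hull. -/
noncomputable def affDim {d : ℕ} (X : Set (EuclideanSpace ℝ (Fin d))) : ℕ :=
  Module.finrank ℝ (affineSpan ℝ X).direction

/-- The `i`-th successive minimum (`1 ≤ i ≤ d`) of a lattice `Λ` and a convex body `K` in `ℝ^d`:
the infimum of the dilation factors `t ≥ 0` for which `Λ ∩ tK` has dimension at least `i`. -/
noncomputable def successiveMinimum {d : ℕ} (Λ : Submodule ℤ (EuclideanSpace ℝ (Fin d)))
    (K : ConvexBody (EuclideanSpace ℝ (Fin d))) (i : ℕ) : ℝ :=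
  sInf {t : ℝ | 0 ≤ t ∧
    i ≤ affDim ((Λ : Set (EuclideanSpace ℝ (Fin d))) ∩
      t • (K : Set (EuclideanSpace ℝ (Fin d))))}

/-- `IsAffineCover k 𝒜 P`: `𝒜` is a collection of `k`-dimensional (in particular, non-empty)
affine subspaces of `ℝ^d`, and every point of `P` lies in some member of `𝒜`. -/
def IsAffineCover {d : ℕ} (k : ℕ) (𝒜 : Set (AffineSubspace ℝ (EuclideanSpace ℝ (Fin d))))
    (P : Set (EuclideanSpace ℝ (Fin d))) : Prop :=
  (∀ A ∈ 𝒜, (A : Set (EuclideanSpace ℝ (Fin d))).Nonempty ∧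
    Module.finrank ℝ A.direction = k) ∧
  ∀ x ∈ P, ∃ A ∈ 𝒜, x ∈ A

/-!
Let `N` be the gauge of `K`, a norm whose closed balls are the dilates of `K`. Choosing vectors of
the lattice greedily, each of minimal norm outside the span of the previous ones, gives a basis
`b` of the space with `N (b i) = λ_{i+1}` (`exists_isGreedyBasis`, `successiveMinimum_eq`). Every
lattice vector of norm less than `N (b i)` lies in the span of the `b j` with `j < i`
(`IsGreedyBasis`), and this property alone yields both bounds.

*Upper bound.* The greedy basis is almost orthogonal: the coordinates of a point of `K` satisfy
`|xᵢ| ≤ B / N (b i)` with `B` depending only on `d` (`IsGreedyBasis.abs_repr_mul_le`). The key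
case is that of the last non-zero coordinate, which follows from Dirichlet's pigeonhole argument
applied to the multiples of the point modulo the lattice spanned by `b`. On the other hand, a
lattice vector with all coordinates less than `1 / d` vanishes
(`IsGreedyBasis.eq_zero_of_abs_repr_lt`). So, modulo the span of `b 0, …, b (k - 1)`, the lattice
points in `K` are separated by cells of side `1 / d` in the last `d - k` coordinates and in the
fractional parts of the first `k` ones. The number of cells is at most a constant times
`∏_{i ≥ k} 1 / N (b i)`, because all `N (b i)` are at most one (`IsGreedyBasis.exists_cover`).

*Lower bound.* The integer combinations of the `b i` with coefficients at most `1 / (d N (b i))`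
in absolute value lie in `K` and form a box whose sides `nᵢ` decrease. A `k`-flat is parametrised
by `k` of the coordinates, so it contains at most `n₀ ⋯ n_{k-1}` points of the box, and at least
`∏_{i ≥ k} nᵢ` flats are needed (`IsGreedyBasis.le_card_cover`).
-/

open Module Finset

/-! ### Greedy bases and their almost orthogonality -/

/-- A basis of a real vector space consisting of vectors of `Λ` chosen greedily with respect to the
seminorm `N`: each `b i` minimises `N` among the vectors of `Λ` outside the span of the preceding
basis vectors. The last field expresses this through coordinates: a vector lies outside the span of
the `b j` with `j < i` iff it has a non-zero coordinate of index at least `i`. -/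
structure IsGreedyBasis {E : Type*} [AddCommGroup E] [Module ℝ E] {d : ℕ} (Λ : Submodule ℤ E)
    (N : Seminorm ℝ E) (b : Basis (Fin d) ℝ E) : Prop where
  mem : ∀ i, b i ∈ Λ
  pos : ∀ i, 0 < N (b i)
  le_of_repr_ne_zero : ∀ z ∈ Λ, ∀ i j, i ≤ j → b.repr z j ≠ 0 → N (b i) ≤ N z

theorem Seminorm.le_sum_abs_repr_mul {E : Type*} [AddCommGroup E] [Module ℝ E] {ι : Type*}
    [Fintype ι] (N : Seminorm ℝ E) (b : Basis ι ℝ E) (x : E) :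
    N x ≤ ∑ i, |b.repr x i| * N (b i) := by
  conv_lhs => rw [← b.sum_repr x]
  refine (le_sum_of_subadditive N (map_zero N).le (map_add_le_add N) _ _).trans (le_of_eq ?_)
  simp [map_smul_eq_mul]

theorem sum_zsmul_mem {E ι : Type*} [AddCommGroup E] [Module ℝ E] (Λ : Submodule ℤ E) {b : ι → E}
    (hb : ∀ i, b i ∈ Λ) (s : Finset ι) (f : ι → ℤ) : ∑ i ∈ s, (f i : ℝ) • b i ∈ Λ := by
  refine Λ.sum_mem fun i _ => ?_
  rw [Int.cast_smul_eq_zsmul]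
  exact Λ.smul_mem _ (hb i)

namespace IsGreedyBasis

variable {E : Type*} [AddCommGroup E] [Module ℝ E] {d : ℕ} {Λ : Submodule ℤ E}
  {N : Seminorm ℝ E} {b : Basis (Fin d) ℝ E}

theorem monotone (h : IsGreedyBasis Λ N b) : Monotone fun i => N (b i) := fun i j hij =>
  h.le_of_repr_ne_zero _ (h.mem j) i j hij (by simp)

/-- The only vector of `Λ` whose coordinates are all smaller than `1 / d` is zero: if `m` is the
last index with a non-zero coordinate, the triangle inequality gives `N z < N (b m)`. -/
theorem eq_zero_of_abs_repr_lt (h : IsGreedyBasis Λ N b) {z : E} (hz : z ∈ Λ)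
    (hlt : ∀ i, |b.repr z i| * d < 1) : z = 0 := by
  by_contra hne
  obtain ⟨i, hi⟩ : ∃ i, b.repr z i ≠ 0 := by
    by_contra! hall
    exact hne (b.ext_elem (by simpa using hall))
  obtain ⟨m, hm, hmax⟩ := (univ.filter fun i => b.repr z i ≠ 0).exists_max_image id
    ⟨i, by simpa using hi⟩
  have hd : (0 : ℝ) < d := by exact_mod_cast Fin.pos m
  have h1 : N z < ∑ _i : Fin d, (1 / d : ℝ) * N (b m) := by
    refine (N.le_sum_abs_repr_mul b z).trans_lt (sum_lt_sum_of_nonempty ⟨m, mem_univ m⟩ ?_)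
    intro j _
    by_cases hj : b.repr z j = 0
    · rw [hj, abs_zero, zero_mul]
      exact mul_pos (by positivity) (h.pos m)
    · have hjm : N (b j) ≤ N (b m) := h.monotone (hmax j (by simpa using hj))
      calc |b.repr z j| * N (b j) ≤ |b.repr z j| * N (b m) := by gcongr
        _ < 1 / d * N (b m) := by
          gcongr
          · exact h.pos m
          · rw [lt_div_iff₀ hd]; exact hlt j
  have h2 := h.le_of_repr_ne_zero z hz m m le_rfl (by simpa using hm)
  rw [sum_const, card_univ, Fintype.card_fin, nsmul_eq_mul, ← mul_assoc,
    mul_one_div_cancel hd.ne', one_mul] at h1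
  exact absurd h1 h2.not_gt

/-- Dirichlet's pigeonhole argument: among the first multiples of `y`, two are nearly congruent
modulo the lattice spanned by `b`. Their difference is close to a vector of `Λ` whose `m`-th
coordinate is non-zero, so `N y` cannot be much smaller than `N (b m)`. -/
theorem le_mul_of_repr_eq_one (h : IsGreedyBasis Λ N b) (m : Fin d) (y : E)
    (hy : b.repr y m = 1) (hy0 : ∀ j, m < j → b.repr y j = 0) :
    N (b m) ≤ 2 * (2 * d) ^ d * N y := by
  have hd : (0 : ℝ) < d := by exact_mod_cast Fin.pos m
  let cell : ℕ → Fin d → ℤ := fun j l => ⌊(2 * d : ℝ) * Int.fract (j * b.repr y l)⌋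
  obtain ⟨p, hp, q, hq, hpq, hcell⟩ := exists_ne_map_eq_of_card_lt_of_maps_to
    (s := range ((2 * d) ^ d + 1)) (t := Fintype.piFinset fun _ : Fin d => Ico (0 : ℤ) (2 * d))
    (by simp [Fintype.card_piFinset]; norm_cast) (f := cell) (by
      intro j _
      simp only [Finset.mem_coe, Fintype.mem_piFinset, mem_Ico, cell]
      refine fun l => ⟨Int.floor_nonneg.2 (mul_nonneg (by positivity) (Int.fract_nonneg _)), ?_⟩
      rw [Int.floor_lt]
      push_cast
      exact mul_lt_of_lt_one_right (by positivity) (Int.fract_lt_one _))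
  -- The difference of the coordinatewise integer parts of `p • y` and `q • y`; it differs from
  -- `(p - q) • y` by less than `1 / (2 * d)` in every coordinate.
  let z : E := ∑ l, ((⌊p * b.repr y l⌋ - ⌊q * b.repr y l⌋ : ℤ) : ℝ) • b l
  have hz : z ∈ Λ := sum_zsmul_mem Λ h.mem _ _
  have hzr : ∀ l, b.repr z l = ⌊p * b.repr y l⌋ - ⌊q * b.repr y l⌋ := by
    intro l
    simp only [z, b.repr_sum_self]
    push_cast
    rfl
  have h1 : N (b m) ≤ N z := by
    refine h.le_of_repr_ne_zero z hz m m le_rfl ?_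
    rw [hzr, hy, mul_one, mul_one, Int.floor_natCast, Int.floor_natCast, sub_ne_zero]
    exact_mod_cast hpq
  have h2 : N (z - ((p : ℝ) - q) • y) ≤ N (b m) / 2 := by
    refine (N.le_sum_abs_repr_mul b _).trans ?_
    calc _ ≤ ∑ _l : Fin d, (1 / (2 * d) : ℝ) * N (b m) := ?_
      _ = N (b m) / 2 := by
        rw [sum_const, card_univ, Fintype.card_fin, nsmul_eq_mul]
        field_simp
    refine sum_le_sum fun l _ => ?_
    have hr : b.repr (z - ((p : ℝ) - q) • y) l =
        Int.fract (q * b.repr y l) - Int.fract (p * b.repr y l) := by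
      simp only [map_sub, map_smul, Finsupp.sub_apply, Finsupp.smul_apply, hzr, smul_eq_mul,
        Int.fract]
      ring
    rcases lt_or_ge m l with hml | hlm
    · simp only [hr, hy0 l hml, mul_zero, Int.fract_zero, sub_zero, abs_zero, zero_mul]
      exact mul_nonneg (by positivity) (h.pos m).le
    · have habs : |b.repr (z - ((p : ℝ) - q) • y) l| ≤ 1 / (2 * d) := by
        have := Int.abs_sub_lt_one_of_floor_eq_floor (congrFun hcell l)
        rw [hr, abs_sub_comm, le_div_iff₀ (by positivity)]
        rw [← mul_sub, abs_mul, abs_of_pos (by positivity : (0 : ℝ) < 2 * d)] at this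
        linarith
      have := h.monotone hlm
      exact mul_le_mul habs this (apply_nonneg N _) (by positivity)
  have h3 : N (((p : ℝ) - q) • y) ≤ (2 * d) ^ d * N y := by
    rw [map_smul_eq_mul]
    refine mul_le_mul_of_nonneg_right ?_ (apply_nonneg N _)
    have hp' : (p : ℝ) ≤ (2 * d) ^ d := by exact_mod_cast Nat.lt_succ_iff.1 (mem_range.1 hp)
    have hq' : (q : ℝ) ≤ (2 * d) ^ d := by exact_mod_cast Nat.lt_succ_iff.1 (mem_range.1 hq)
    have hp0 : (0 : ℝ) ≤ p := p.cast_nonneg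
    have hq0 : (0 : ℝ) ≤ q := q.cast_nonneg
    rw [Real.norm_eq_abs, abs_le]
    constructor <;> linarith
  have h4 : N z ≤ N (z - ((p : ℝ) - q) • y) + N (((p : ℝ) - q) • y) := by
    simpa using map_add_le_add N (z - ((p : ℝ) - q) • y) (((p : ℝ) - q) • y)
  linarith

theorem abs_repr_mul_le_of_last (h : IsGreedyBasis Λ N b) (m : Fin d) (y : E)
    (hy0 : ∀ j, m < j → b.repr y j = 0) :
    |b.repr y m| * N (b m) ≤ 2 * (2 * d) ^ d * N y := by
  by_cases hm : b.repr y m = 0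
  · rw [hm, abs_zero, zero_mul]
    positivity
  · have := h.le_mul_of_repr_eq_one m ((b.repr y m)⁻¹ • y) (by simp [hm])
      (fun j hj => by simp [hy0 j hj])
    rw [map_smul_eq_mul, norm_inv, Real.norm_eq_abs] at this
    have hpos := abs_pos.2 hm
    calc |b.repr y m| * N (b m)
        ≤ |b.repr y m| * (2 * (2 * d) ^ d * (|b.repr y m|⁻¹ * N y)) := by gcongr
      _ = 2 * (2 * d) ^ d * N y := by field_simp

/-- A greedy basis is almost orthogonal: every term `(b.repr y i) • b i` in the expansion of `y` is
of `N`-size at most a constant multiple of `N y`. The coordinates are peeled off starting from the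
last. -/
theorem abs_repr_mul_le_of_support (h : IsGreedyBasis Λ N b) (m : ℕ) (y : E)
    (hy0 : ∀ j : Fin d, m ≤ j → b.repr y j = 0) (i : Fin d) :
    |b.repr y i| * N (b i) ≤ 2 * (2 * d) ^ d * (1 + 2 * (2 * d) ^ d) ^ m * N y := by
  set B : ℝ := 2 * (2 * d) ^ d with hB
  have hB0 : 0 ≤ B := by positivity
  induction m generalizing y with
  | zero =>
    rw [hy0 i (Nat.zero_le _), abs_zero, zero_mul]
    positivity
  | succ m ih =>
    by_cases hmd : m < d
    · have htop := h.abs_repr_mul_le_of_last ⟨m, hmd⟩ y fun j hj => hy0 j hj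
      rw [← hB] at htop
      by_cases him : i = ⟨m, hmd⟩
      · rw [him]
        refine htop.trans (mul_le_mul_of_nonneg_right ?_ (apply_nonneg N y))
        exact le_mul_of_one_le_right hB0 (one_le_pow₀ (by linarith))
      · let y' := y - b.repr y ⟨m, hmd⟩ • b ⟨m, hmd⟩
        have hy' : ∀ j, j ≠ ⟨m, hmd⟩ → b.repr y' j = b.repr y j := by
          intro j hj
          simp [y', hj.symm]
        have hN : N y' ≤ (1 + B) * N y := by
          have := map_sub_le_add N y (b.repr y ⟨m, hmd⟩ • b ⟨m, hmd⟩)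
          rw [map_smul_eq_mul, Real.norm_eq_abs] at this
          linarith
        have := ih y' fun j hj => by
          by_cases hjm : j = ⟨m, hmd⟩
          · simp [y', hjm]
          · rw [hy' j hjm]
            exact hy0 j (Nat.lt_of_le_of_ne hj fun e => hjm (Fin.ext e.symm))
        rw [hy' i him] at this
        calc _ ≤ B * (1 + B) ^ m * N y' := this
          _ ≤ B * (1 + B) ^ m * ((1 + B) * N y) := by gcongr
          _ = B * (1 + B) ^ (m + 1) * N y := by ring
    · refine (ih y fun j hj => absurd (hj.trans_lt j.2) hmd).trans ?_
      gcongr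
      · linarith
      · simp

theorem abs_repr_mul_le (h : IsGreedyBasis Λ N b) (y : E) (i : Fin d) :
    |b.repr y i| * N (b i) ≤ 2 * (2 * d) ^ d * (1 + 2 * (2 * d) ^ d) ^ d * N y :=
  h.abs_repr_mul_le_of_support d y (fun j hj => absurd hj j.2.not_ge) i

end IsGreedyBasis

/-! ### Coordinates, subspaces and boxes -/

theorem Module.Basis.mem_span_image_lt_iff {E : Type*} [AddCommGroup E] [Module ℝ E] {d : ℕ}
    (b : Basis (Fin d) ℝ E) (k : ℕ) (x : E) :
    x ∈ Submodule.span ℝ (b '' {i | (i : ℕ) < k}) ↔ ∀ j : Fin d, k ≤ j → b.repr x j = 0 := by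
  rw [b.mem_span_image, Set.subset_def]
  refine forall_congr' fun j => ?_
  simp only [Finset.mem_coe, Finsupp.mem_support_iff, Set.mem_ofPred_eq]
  rw [← not_imp_not, not_not, not_lt]

theorem Module.Basis.finrank_span_image_lt {E : Type*} [AddCommGroup E] [Module ℝ E] {d : ℕ}
    (b : Basis (Fin d) ℝ E) {k : ℕ} (hk : k ≤ d) :
    finrank ℝ (Submodule.span ℝ (b '' {i | (i : ℕ) < k})) = k := by
  classical
  have h := finrank_span_set_eq_card 
    ((b.linearIndependent.linearIndepOn (s := {i | (i : ℕ) < k})).id_image)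
  rw [h, Set.toFinset_image, card_image_of_injective _ b.injective]
  simp [Fin.card_filter_val_lt, hk]

/-- The product of at most `k` values of an antitone sequence is at most the product of its first
`k` values, as long as all values are at least one. -/
theorem prod_le_prod_filter_lt {d k : ℕ} (hk : k < d) (n : Fin d → ℕ) (hn : Antitone n)
    (h1 : ∀ i, 1 ≤ n i) (S : Finset (Fin d)) (hS : #S ≤ k) :
    ∏ i ∈ S, n i ≤ ∏ i with i.val < k, n i := by
  set L : Finset (Fin d) := univ.filter fun i => i.val < k
  have hL : #L = k := by simp [L, Fin.card_filter_val_lt, hk.le]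
  have hcard : #(S \ L) ≤ #(L \ S) := by
    have h2 := card_sdiff_add_card_inter S L
    have h3 := card_sdiff_add_card_inter L S
    rw [inter_comm] at h3
    omega
  rw [← prod_inter_mul_prod_sdiff S L n, ← prod_inter_mul_prod_sdiff L S n, inter_comm]
  refine Nat.mul_le_mul_left _ ?_
  calc ∏ i ∈ S \ L, n i ≤ n ⟨k, hk⟩ ^ #(S \ L) := prod_le_pow_card _ _ _ fun i hi => hn (by
        have := (mem_sdiff.1 hi).2
        simp only [L, mem_filter, mem_univ, true_and, not_lt] at this
        exact this)
    _ ≤ n ⟨k, hk⟩ ^ #(L \ S) := Nat.pow_le_pow_right (h1 _) hcard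
    _ ≤ ∏ i ∈ L \ S, n i := pow_card_le_prod _ _ _ fun i hi => hn (by
        have := (mem_sdiff.1 hi).1
        simp only [L, mem_filter, mem_univ, true_and] at this
        exact this.le)

/-- A subspace of dimension `r` is parametrised by at most `r` of the coordinates. -/
theorem Module.Basis.exists_card_le_finrank_forall_repr_eq_zero {E ι : Type*} [AddCommGroup E]
    [Module ℝ E] [Fintype ι] [DecidableEq ι] (b : Basis ι ℝ E) (r : ℕ) (W : Submodule ℝ E)
    (hW : finrank ℝ W = r) :
    ∃ S : Finset ι, #S ≤ r ∧ ∀ w ∈ W, (∀ i ∈ S, b.repr w i = 0) → w = 0 := by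
  have := b.finiteDimensional_of_finite
  induction r using Nat.strong_induction_on generalizing W with
  | _ r ih =>
    by_cases hbot : W = ⊥
    · exact ⟨∅, by simp, fun w hw _ => by simpa [hbot] using hw⟩
    · obtain ⟨w, hw, hw0⟩ := W.exists_mem_ne_zero_of_ne_bot hbot
      obtain ⟨i, hi⟩ : ∃ i, b.repr w i ≠ 0 := by
        by_contra! hall
        exact hw0 (b.ext_elem (by simpa using hall))
      have hlt : W ⊓ LinearMap.ker (b.coord i) < W :=
        inf_le_left.lt_of_ne fun e => hi (by
          have := inf_eq_left.1 e hw
          simpa using this)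
      have hfin := Submodule.finrank_lt_finrank_of_lt hlt
      obtain ⟨S, hS, hS0⟩ := ih _ (hW ▸ hfin) _ rfl
      refine ⟨insert i S, (card_insert_le _ _).trans (by omega), fun x hx hx0 => ?_⟩
      refine hS0 x ⟨hx, ?_⟩ fun j hj => hx0 j (mem_insert_of_mem hj)
      simpa using hx0 i (mem_insert_self i S)

/-- A flat of dimension `r` meets a box of integer points in at most as many points as some
coordinate face of the box of dimension at most `r` has. -/
theorem Module.Basis.exists_card_filter_mem_le_prod {E ι : Type*} [AddCommGroup E] [Module ℝ E]
    [Fintype ι] [DecidableEq ι] (b : Basis ι ℝ E) (I : ι → Finset ℤ) (A : AffineSubspace ℝ E)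
    [DecidablePred fun a : ι → ℤ => ∑ i, (a i : ℝ) • b i ∈ A] :
    ∃ S : Finset ι, #S ≤ finrank ℝ A.direction ∧
      #{a ∈ Fintype.piFinset I | ∑ i, (a i : ℝ) • b i ∈ A} ≤ ∏ i ∈ S, #(I i) := by
  obtain ⟨S, hS, hS0⟩ := b.exists_card_le_finrank_forall_repr_eq_zero _ A.direction rfl
  refine ⟨S, hS, ?_⟩
  have hcard : ∏ i ∈ S, #(I i) = #(Fintype.piFinset fun i => if i ∈ S then I i else {0}) := by
    rw [Fintype.card_piFinset, ← Finset.prod_subset (subset_univ S)]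
    · exact prod_congr rfl fun i hi => by simp [hi]
    · intro i _ hi
      simp [hi]
  rw [hcard]
  refine card_le_card_of_injOn (fun a i => if i ∈ S then a i else 0) ?_ ?_
  · intro a ha
    simp only [Finset.mem_coe, mem_filter, Fintype.mem_piFinset] at ha ⊢
    intro i
    split_ifs
    · exact ha.1 i
    · simp
  · intro a ha a' ha' haa'
    simp only [Finset.mem_coe, mem_filter] at ha ha'
    have hmem := AffineSubspace.vsub_mem_direction ha.2 ha'.2
    rw [vsub_eq_sub] at hmem
    have hr : ∀ i, b.repr (∑ i, (a i : ℝ) • b i - ∑ i, (a' i : ℝ) • b i) i = a i - a' i := by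
      intro i
      rw [map_sub, Finsupp.sub_apply, b.repr_sum_self, b.repr_sum_self]
    have h0 := hS0 _ hmem fun i hi => by
      have := congrFun haa' i
      simp only [hi, if_true] at this
      rw [hr, this, sub_self]
    funext i
    have := hr i
    rw [h0, map_zero, Finsupp.zero_apply] at this
    exact_mod_cast (sub_eq_zero.1 this.symm)

/-! ### Covering the lattice points of the unit ball by flats -/

namespace IsGreedyBasis

variable {E : Type*} [AddCommGroup E] [Module ℝ E] {d : ℕ} {Λ : Submodule ℤ E}
  {N : Seminorm ℝ E} {b : Basis (Fin d) ℝ E}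

/-- The points of `Λ` in the unit ball of `N` are covered by the translates of the span of the
first `k` basis vectors. Two points whose last `d - k` coordinates and the fractional parts of
whose first `k` coordinates lie in the same cell of side `1 / d` are in the same translate, so it
suffices to count cells. -/
theorem exists_cover (h : IsGreedyBasis Λ N b) {k : ℕ} (hk : k < d) (hle : ∀ i, N (b i) ≤ 1)
    (F : Finset E) (hF : ∀ x ∈ F, x ∈ Λ ∧ N x ≤ 1) :
    ∃ 𝒜 : Finset (AffineSubspace ℝ E),
      (∀ A ∈ 𝒜, (A : Set E).Nonempty ∧ finrank ℝ A.direction = k) ∧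
      (∀ x ∈ F, ∃ A ∈ 𝒜, x ∈ A) ∧
      (#𝒜 : ℝ) ≤ (2 * d * (2 * (2 * d) ^ d * (1 + 2 * (2 * d) ^ d) ^ d) + 2) ^ d *
        ∏ i with k ≤ i.val, (N (b i))⁻¹ := by
  classical
  have hd : (0 : ℝ) < d := by exact_mod_cast (Nat.zero_le k).trans_lt hk
  set B : ℝ := 2 * (2 * d) ^ d * (1 + 2 * (2 * d) ^ d) ^ d with hB
  have hB1 : 1 ≤ B := by
    have h1 : (1 : ℝ) ≤ (2 * d) ^ d := one_le_pow₀ (by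
      have : (1 : ℝ) ≤ d := by exact_mod_cast (Nat.zero_le k).trans_lt hk
      linarith)
    have h2 : (1 : ℝ) ≤ (1 + 2 * (2 * d) ^ d) ^ d := one_le_pow₀ (by linarith)
    rw [hB]
    nlinarith
  set W := Submodule.span ℝ (b '' {i | (i : ℕ) < k}) with hW
  let f : E → AffineSubspace ℝ E := fun x => AffineSubspace.mk' x W
  -- The coordinates on which the translates of `W` are told apart, the first `k` modulo `1`.
  let c : E → Fin d → ℝ := fun x i => if i.val < k then Int.fract (b.repr x i) else b.repr x i
  let cell : E → Fin d → ℤ := fun x i => ⌊(d : ℝ) * c x i⌋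
  let J : Fin d → Finset ℤ := fun i => if i.val < k then Ico 0 (d : ℤ) else
    Icc (-⌈d * (B * (N (b i))⁻¹)⌉) ⌊d * (B * (N (b i))⁻¹)⌋
  have hcell : ∀ x ∈ F, cell x ∈ Fintype.piFinset J := by
    intro x hx
    rw [Fintype.mem_piFinset]
    intro i
    by_cases hi : i.val < k
    · simp only [cell, J, c, hi, if_true, mem_Ico]
      refine ⟨Int.floor_nonneg.2 (mul_nonneg hd.le (Int.fract_nonneg _)), ?_⟩
      rw [Int.floor_lt]
      exact mul_lt_of_lt_one_right (by exact_mod_cast hd) (Int.fract_lt_one _)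
    · simp only [cell, J, c, hi, if_false, mem_Icc]
      have h1 : |b.repr x i| ≤ B * (N (b i))⁻¹ := by
        rw [← div_eq_mul_inv, le_div_iff₀ (h.pos i)]
        exact (h.abs_repr_mul_le x i).trans (mul_le_of_le_one_right (by linarith) (hF x hx).2)
      rw [abs_le] at h1
      constructor
      · rw [← Int.floor_neg]
        refine Int.floor_le_floor ?_
        rw [← mul_neg]
        exact mul_le_mul_of_nonneg_left h1.1 hd.le
      · exact Int.floor_le_floor (mul_le_mul_of_nonneg_left h1.2 hd.le)
  have hinj : ∀ x ∈ F, ∀ y ∈ F, cell x = cell y → f x = f y := by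
    intro x hx y hy hxy
    -- Modulo the first `k` basis vectors, `x - y` is congruent to the lattice vector `z` whose
    -- coordinates are all smaller than `1 / d`.
    let z := x - y - ∑ i, ((if i.val < k then ⌊b.repr x i⌋ - ⌊b.repr y i⌋ else 0 : ℤ) : ℝ) • b i
    have hz : z ∈ Λ := Λ.sub_mem (Λ.sub_mem (hF x hx).1 (hF y hy).1) (sum_zsmul_mem Λ h.mem _ _)
    have hzr : ∀ i, b.repr z i = c x i - c y i := by
      intro i
      simp only [z, map_sub, Finsupp.sub_apply, b.repr_sum_self, c, Int.fract]
      split_ifs <;> push_cast <;> ring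
    have hz0 : z = 0 := h.eq_zero_of_abs_repr_lt hz fun i => by
      have := Int.abs_sub_lt_one_of_floor_eq_floor (congrFun hxy i)
      rw [← mul_sub, abs_mul, abs_of_pos hd] at this
      rwa [hzr, mul_comm]
    have hxyW : x - y ∈ W := by
      rw [hW, b.mem_span_image_lt_iff]
      intro j hj
      have := hzr j
      simp only [hz0, map_zero, Finsupp.zero_apply, c, hj.not_gt, if_false] at this
      rw [map_sub, Finsupp.sub_apply]
      exact this.symm
    refine (AffineSubspace.ext_of_direction_eq (by simp [f]) ⟨x, ?_, ?_⟩)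
    · exact AffineSubspace.self_mem_mk' x W
    · simpa [f, AffineSubspace.mem_mk'] using hxyW
  refine ⟨F.image f, ?_, fun x hx => ⟨f x, mem_image_of_mem f hx, AffineSubspace.self_mem_mk' x W⟩,
    ?_⟩
  · intro A hA
    obtain ⟨x, -, rfl⟩ := mem_image.1 hA
    refine ⟨⟨x, AffineSubspace.self_mem_mk' x W⟩, ?_⟩
    have hdir : (f x).direction = W := AffineSubspace.direction_mk' x W
    rw [hdir]
    exact b.finrank_span_image_lt hk.le
  have hcard : #(F.image f) ≤ #(Fintype.piFinset J) := by
    choose! g hgF hg using fun A (hA : A ∈ F.image f) => mem_image.1 hA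
    refine card_le_card_of_injOn (fun A => cell (g A)) (fun A hA => hcell _ (hgF A hA)) ?_
    intro A hA A' hA' e
    rw [← hg A hA, ← hg A' hA']
    exact hinj _ (hgF A hA) _ (hgF A' hA') e
  calc (#(F.image f) : ℝ) ≤ #(Fintype.piFinset J) := by exact_mod_cast hcard
    _ = ∏ i, (#(J i) : ℝ) := by rw [Fintype.card_piFinset]; push_cast; rfl
    _ ≤ ∏ i, (2 * d * B + 2) * (if k ≤ i.val then (N (b i))⁻¹ else 1) := by
      refine prod_le_prod (fun i _ => Nat.cast_nonneg _) fun i _ => ?_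
      by_cases hi : i.val < k
      · simp only [J, hi, if_true, hi.not_ge, if_false, Int.card_Ico, sub_zero, Int.toNat_natCast]
        nlinarith
      · have hinv : 1 ≤ (N (b i))⁻¹ := (one_le_inv₀ (h.pos i)).2 (hle i)
        have hnn : 0 ≤ d * (B * (N (b i))⁻¹) := by positivity
        simp only [J, hi, if_false, not_lt.1 hi, if_true, Int.card_Icc]
        have h1 := Int.floor_le (d * (B * (N (b i))⁻¹))
        have h2 := Int.ceil_lt_add_one (d * (B * (N (b i))⁻¹))
        have h3 : 0 ≤ ⌊d * (B * (N (b i))⁻¹)⌋ := Int.floor_nonneg.2 hnn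
        have h4 : 0 ≤ ⌈d * (B * (N (b i))⁻¹)⌉ := Int.ceil_nonneg hnn
        have h5 : ((⌊d * (B * (N (b i))⁻¹)⌋ + 1 - -⌈d * (B * (N (b i))⁻¹)⌉).toNat : ℝ) =
            ⌊d * (B * (N (b i))⁻¹)⌋ + 1 + ⌈d * (B * (N (b i))⁻¹)⌉ := by
          have := Int.toNat_of_nonneg
            (by omega : 0 ≤ ⌊d * (B * (N (b i))⁻¹)⌋ + 1 - -⌈d * (B * (N (b i))⁻¹)⌉)
          rw [← Int.cast_natCast, this]
          push_cast
          ring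
        rw [h5]
        linarith
    _ = _ := by
      rw [prod_mul_distrib, prod_const, card_univ, Fintype.card_fin, prod_filter]

/-- The points `∑ aᵢ bᵢ` with integers `|aᵢ| ≤ 1 / (d N(bᵢ))` lie in the unit ball of `N`, and a
`k`-flat contains at most as many of them as the `k` longest sides of this box allow. -/
theorem le_card_cover (h : IsGreedyBasis Λ N b) {k : ℕ} (hk : k < d)
    (𝒜 : Finset (AffineSubspace ℝ E)) (hdim : ∀ A ∈ 𝒜, finrank ℝ A.direction = k)
    (hcov : ∀ x ∈ Λ, N x ≤ 1 → ∃ A ∈ 𝒜, x ∈ A) :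
    (1 / d : ℝ) ^ d * ∏ i with k ≤ i.val, (N (b i))⁻¹ ≤ #𝒜 := by
  classical
  have hd1 : (1 : ℝ) ≤ d := by exact_mod_cast (Nat.zero_le k).trans_lt hk
  have hd : (0 : ℝ) < d := by linarith
  let m : Fin d → ℕ := fun i => ⌊1 / (d * N (b i))⌋₊
  let I : Fin d → Finset ℤ := fun i => Icc (-(m i : ℤ)) (m i)
  have hI : ∀ i, #(I i) = 2 * m i + 1 := by
    intro i
    simp only [I, Int.card_Icc]
    omega
  have hanti : Antitone fun i => #(I i) := by
    intro i j hij
    simp only [hI]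
    have : m j ≤ m i := by
      refine Nat.floor_le_floor ?_
      have := h.pos i
      have := h.monotone hij
      dsimp only at this
      gcongr
    omega
  have hmem : ∀ a ∈ Fintype.piFinset I, ∃ A ∈ 𝒜, ∑ i, (a i : ℝ) • b i ∈ A := by
    intro a ha
    refine hcov _ (sum_zsmul_mem Λ h.mem _ _) ((N.le_sum_abs_repr_mul b _).trans ?_)
    calc _ ≤ ∑ _i : Fin d, (1 / d : ℝ) := sum_le_sum fun i _ => ?_
      _ = 1 := by
        rw [sum_const, card_univ, Fintype.card_fin, nsmul_eq_mul, mul_one_div_cancel hd.ne']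
    have hai := mem_Icc.1 (Fintype.mem_piFinset.1 ha i)
    have h1 : (|a i| : ℝ) ≤ m i := by exact_mod_cast abs_le.2 hai
    have hpos := h.pos i
    have h2 : (m i : ℝ) ≤ 1 / (d * N (b i)) := Nat.floor_le (by positivity)
    rw [b.repr_sum_self]
    calc |(a i : ℝ)| * N (b i) ≤ 1 / (d * N (b i)) * N (b i) := by gcongr; exact h1.trans h2
      _ = 1 / d := by field_simp
  let G : AffineSubspace ℝ E → Finset (Fin d → ℤ) := fun A =>
    {a ∈ Fintype.piFinset I | ∑ i, (a i : ℝ) • b i ∈ A}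
  have hflat : ∀ A ∈ 𝒜, #(G A) ≤ ∏ i with i.val < k, #(I i) := by
    intro A hA
    obtain ⟨S, hS, hle⟩ := b.exists_card_filter_mem_le_prod I A
    exact hle.trans (prod_le_prod_filter_lt hk _ hanti (fun i => by rw [hI]; omega) S
      (hS.trans_eq (hdim A hA)))
  have htotal : ∏ i, #(I i) ≤ #𝒜 * ∏ i with i.val < k, #(I i) := by
    rw [← Fintype.card_piFinset]
    refine (card_le_card fun a ha => ?_).trans (card_biUnion_le_card_mul 𝒜 G _ hflat)
    obtain ⟨A, hA, haA⟩ := hmem a ha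
    exact mem_biUnion.2 ⟨A, hA, mem_filter.2 ⟨ha, haA⟩⟩
  have hN : ∏ i with k ≤ i.val, #(I i) ≤ #𝒜 := by
    rw [← prod_filter_not_mul_prod_filter univ (fun i : Fin d => i.val < k)] at htotal
    simp only [not_lt] at htotal
    exact Nat.le_of_mul_le_mul_right htotal (prod_pos fun i _ => by rw [hI]; omega)
  calc (1 / d : ℝ) ^ d * ∏ i with k ≤ i.val, (N (b i))⁻¹
      ≤ (1 / d : ℝ) ^ #{i : Fin d | k ≤ i.val} * ∏ i with k ≤ i.val, (N (b i))⁻¹ := by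
        refine mul_le_mul_of_nonneg_right ?_
          (prod_nonneg fun i _ => inv_nonneg.2 (apply_nonneg N _))
        refine pow_le_pow_of_le_one (by positivity) ((div_le_one hd).2 hd1) ?_
        exact (card_le_univ _).trans_eq (Fintype.card_fin d)
    _ = ∏ i with k ≤ i.val, 1 / (d * N (b i)) := by
        rw [← prod_const, ← prod_mul_distrib]
        refine prod_congr rfl fun i _ => ?_
        rw [one_div, one_div, mul_inv]
    _ ≤ ∏ i with k ≤ i.val, (#(I i) : ℝ) := by
        refine prod_le_prod (fun i _ => by positivity) fun i _ => ?_
        have := Nat.lt_floor_add_one (1 / (d * N (b i)))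
        rw [hI]
        push_cast
        have : (0 : ℝ) ≤ m i := Nat.cast_nonneg _
        simp only [m] at this ⊢
        linarith
    _ ≤ #𝒜 := by exact_mod_cast hN

end IsGreedyBasis

/-! ### Existence of a greedy basis -/

/-- The increasing chain of subspaces that starts at `⊥` and adjoins to each subspace `W` the
vector `pick W`. -/
def adjoinSpan {E : Type*} [AddCommGroup E] [Module ℝ E] (pick : Submodule ℝ E → E) :
    ℕ → Submodule ℝ E
  | 0 => ⊥
  | n + 1 => Submodule.span ℝ {pick (adjoinSpan pick n)} ⊔ adjoinSpan pick n

theorem adjoinSpan_eq_span {E : Type*} [AddCommGroup E] [Module ℝ E] (pick : Submodule ℝ E → E)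
    (n : ℕ) : adjoinSpan pick n =
      Submodule.span ℝ (Set.range fun i : Fin n => pick (adjoinSpan pick i)) := by
  induction n with
  | zero => simp [adjoinSpan]
  | succ n ih =>
    have : (Set.range fun i : Fin (n + 1) => pick (adjoinSpan pick i)) =
        insert (pick (adjoinSpan pick n))
          (Set.range fun i : Fin n => pick (adjoinSpan pick i)) := by
      ext x
      simp [Fin.exists_fin_succ', or_comm, eq_comm]
    rw [this, Submodule.span_insert, ← ih, adjoinSpan]

theorem linearIndependent_pick_adjoinSpan {E : Type*} [AddCommGroup E] [Module ℝ E] {d : ℕ}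
    (pick : Submodule ℝ E → E)
    (hpick : ∀ W : Submodule ℝ E, finrank ℝ W < d → pick W ∉ W) (n : ℕ) (hn : n ≤ d) :
    LinearIndependent ℝ fun i : Fin n => pick (adjoinSpan pick i) := by
  induction n with
  | zero => exact linearIndependent_empty_type
  | succ n ih =>
    have hli := ih (by omega)
    rw [linearIndependent_finSucc']
    refine ⟨hli, ?_⟩
    have hspan := adjoinSpan_eq_span pick n
    have hfin : finrank ℝ (adjoinSpan pick n) = n := by
      rw [hspan, finrank_span_eq_card hli, Fintype.card_fin]
    have := hpick (adjoinSpan pick n) (by omega)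
    rw [hspan] at this
    simpa [Fin.init_def, ← hspan] using this

/-- If the balls of `N` contain finitely many vectors of `Λ` and `Λ` spans the space, then a greedy
basis exists. -/
theorem exists_isGreedyBasis {E : Type*} [AddCommGroup E] [Module ℝ E] [FiniteDimensional ℝ E]
    (Λ : Submodule ℤ E) (N : Seminorm ℝ E) (hN : ∀ x, N x = 0 → x = 0)
    (hfin : ∀ t : ℝ, {x | x ∈ Λ ∧ N x ≤ t}.Finite)
    (hspan : Submodule.span ℝ (Λ : Set E) = ⊤) {d : ℕ} (hd : finrank ℝ E = d) :
    ∃ b : Basis (Fin d) ℝ E, IsGreedyBasis Λ N b := by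
  have hex : ∀ W : Submodule ℝ E, ∃ x, finrank ℝ W < d →
      (x ∈ Λ ∧ x ∉ W ∧ ∀ z ∈ Λ, z ∉ W → N x ≤ N z) := by
    intro W
    by_cases hW : finrank ℝ W < d
    · obtain ⟨y, hy, hyW⟩ : ∃ y ∈ Λ, y ∉ W := by
        by_contra! hall
        have : W = ⊤ := top_le_iff.1 (hspan ▸ Submodule.span_le.2 hall)
        rw [this, finrank_top, hd] at hW
        exact hW.false
      obtain ⟨x, ⟨⟨hx, hxy⟩, hxW⟩, hmin⟩ := Set.exists_min_image
        ({x | x ∈ Λ ∧ N x ≤ N y} ∩ {x | x ∉ W}) N ((hfin _).inter_of_left _)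
        ⟨y, ⟨hy, le_rfl⟩, hyW⟩
      refine ⟨x, fun _ => ⟨hx, hxW, fun z hz hzW => ?_⟩⟩
      rcases le_total (N z) (N y) with h | h
      · exact hmin z ⟨⟨hz, h⟩, hzW⟩
      · exact hxy.trans h
    · exact ⟨0, fun h => absurd h hW⟩
  choose pick hpick using hex
  have hli' := linearIndependent_pick_adjoinSpan pick fun W hW => (hpick W hW).2.1
  have hli := hli' d le_rfl
  have hcard : Fintype.card (Fin d) = finrank ℝ E := by rw [Fintype.card_fin, hd]
  have hrank : ∀ i : Fin d, finrank ℝ (adjoinSpan pick i) < d := by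
    intro i
    rw [adjoinSpan_eq_span, finrank_span_eq_card (hli' i i.2.le), Fintype.card_fin]
    exact i.2
  let b := basisOfLinearIndependentOfCardEqFinrank' _ hli hcard
  have hb : ∀ i, b i = pick (adjoinSpan pick i) := fun i => by simp [b]
  refine ⟨b, fun i => ?_, fun i => ?_, fun z hz i j hij hj => ?_⟩
  · rw [hb]
    exact (hpick _ (hrank i)).1
  · exact (apply_nonneg N _).lt_of_ne fun e => b.ne_zero i (hN _ e.symm)
  · rw [hb]
    refine (hpick _ (hrank i)).2.2 z hz fun hzi => hj ?_
    refine (b.mem_span_image_lt_iff i z).1 ?_ j hij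
    rw [adjoinSpan_eq_span] at hzi
    refine Submodule.span_mono ?_ hzi
    rintro _ ⟨l, rfl⟩
    exact ⟨⟨l, l.2.trans i.2⟩, l.2, hb _⟩

/-! ### Successive minima -/

/-- The gauge of a symmetric convex body with non-empty interior is a norm, whose closed balls are
the dilates of the body. -/
theorem ConvexBody.exists_seminorm {E : Type*} [NormedAddCommGroup E] [NormedSpace ℝ E]
    (K : ConvexBody E) (hsymm : ∀ x ∈ K, -x ∈ K) (hint : (interior (K : Set E)).Nonempty) :
    ∃ N : Seminorm ℝ E, (∀ x, N x = 0 → x = 0) ∧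
      ∀ t : ℝ, 0 ≤ t → ∀ x, x ∈ t • (K : Set E) ↔ N x ≤ t := by
  have hnhds : (K : Set E) ∈ nhds 0 := by
    obtain ⟨x, hx⟩ := hint
    have := K.convex.combo_interior_self_mem_interior hx (hsymm x (interior_subset hx))
      one_half_pos one_half_pos.le (add_halves 1)
    rw [smul_neg, add_neg_cancel] at this
    exact mem_interior_iff_mem_nhds.1 this
  have habs : Absorbent ℝ (K : Set E) := absorbent_nhds_zero hnhds
  have hbal : Balanced ℝ (K : Set E) :=
    (balanced_iff_neg_mem K.convex).2 fun x hx => hsymm x hx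
  have hzero : ∀ x, gauge (K : Set E) x = 0 → x = 0 := fun x hx =>
    (gauge_eq_zero habs ((NormedSpace.isVonNBounded_iff ℝ).2 K.isCompact.isBounded)).1 hx
  refine ⟨gaugeSeminorm hbal K.convex habs, hzero, fun t ht x => ?_⟩
  change _ ↔ gauge (K : Set E) x ≤ t
  rcases ht.eq_or_lt with rfl | ht
  · rw [Set.zero_smul_set K.nonempty, Set.mem_zero]
    exact ⟨fun hx => by rw [hx, gauge_zero], fun hx => hzero x (hx.antisymm (gauge_nonneg x))⟩
  · rw [Set.mem_smul_set_iff_inv_smul_mem₀ ht.ne', ← K.isClosed.closure_eq,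
      ← gauge_le_one_iff_mem_closure K.convex hnhds, gauge_smul_of_nonneg (inv_nonneg.2 ht.le),
      smul_eq_mul, inv_mul_le_iff₀ ht, mul_one, K.isClosed.closure_eq]

/-- The successive minima are the values of the gauge on a greedy basis. -/
theorem successiveMinimum_eq {d : ℕ} {Λ : Submodule ℤ (EuclideanSpace ℝ (Fin d))}
    {K : ConvexBody (EuclideanSpace ℝ (Fin d))} {N : Seminorm ℝ (EuclideanSpace ℝ (Fin d))}
    (hNK : ∀ t : ℝ, 0 ≤ t → ∀ x, x ∈ t • (K : Set (EuclideanSpace ℝ (Fin d))) ↔ N x ≤ t)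
    {b : Basis (Fin d) ℝ (EuclideanSpace ℝ (Fin d))} (h : IsGreedyBasis Λ N b) (i : Fin d) :
    successiveMinimum Λ K (i + 1) = N (b i) := by
  refine IsLeast.csInf_eq ⟨⟨apply_nonneg N _, ?_⟩, ?_⟩
  · rw [affDim, direction_affineSpan]
    refine (b.finrank_span_image_lt (Nat.succ_le_of_lt i.2)).symm.trans_le
      (Submodule.finrank_mono (Submodule.span_le.2 ?_))
    rintro _ ⟨j, hj, rfl⟩
    rw [← sub_zero (b j), ← vsub_eq_sub]
    refine vsub_mem_vectorSpan ℝ ⟨h.mem j, ?_⟩ ⟨Λ.zero_mem, ?_⟩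
    · rw [hNK _ (apply_nonneg N _)]
      exact h.monotone (Nat.lt_succ_iff.1 hj : j ≤ i)
    · rw [hNK _ (apply_nonneg N _), map_zero]
      exact apply_nonneg N _
  · rintro t ⟨ht, hdim⟩
    by_contra! hlt
    have hle : vectorSpan ℝ ((Λ : Set (EuclideanSpace ℝ (Fin d))) ∩
        t • (K : Set (EuclideanSpace ℝ (Fin d)))) ≤
        Submodule.span ℝ (b '' {j | (j : ℕ) < i}) := by
      have hmem : ∀ x ∈ (Λ : Set (EuclideanSpace ℝ (Fin d))) ∩
          t • (K : Set (EuclideanSpace ℝ (Fin d))),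
          x ∈ Submodule.span ℝ (b '' {j | (j : ℕ) < i}) := by
        rintro x ⟨hx, hxK⟩
        rw [b.mem_span_image_lt_iff]
        intro j hij
        by_contra hj
        exact absurd (h.le_of_repr_ne_zero x hx i j hij hj)
          (((hNK t ht x).1 hxK).trans_lt hlt).not_ge
      rw [vectorSpan, Submodule.span_le]
      rintro _ ⟨x, hx, y, hy, rfl⟩
      exact Submodule.sub_mem _ (hmem x hx) (hmem y hy)
    have := Submodule.finrank_mono hle
    rw [b.finrank_span_image_lt i.2.le] at this
    rw [affDim, direction_affineSpan] at hdim
    omega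

theorem prod_filter_le_inv_eq_inv_prod_Icc {d k : ℕ} (f : ℕ → ℝ) :
    ∏ i : Fin d with k ≤ i.val, (f (i + 1))⁻¹ = (∏ i ∈ Icc (k + 1) d, f i)⁻¹ := by
  rw [← prod_inv_distrib]
  refine prod_bij (fun i _ => i.val + 1) (fun i hi => ?_) (fun i _ j _ e => Fin.ext (by omega))
    (fun n hn => ?_) (fun _ _ => rfl)
  · have := (mem_filter.1 hi).2
    simp only [mem_Icc]
    omega
  · rw [mem_Icc] at hn
    exact ⟨⟨n - 1, by omega⟩, by simp; omega, by simp; omega⟩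

theorem theorem4 (d k : ℕ) (hk : 1 ≤ k) (hkd : k + 1 ≤ d) :
    ∃ C c : ℝ, 0 < C ∧ 0 < c ∧
      ∀ (Λ : Submodule ℤ (EuclideanSpace ℝ (Fin d))) [DiscreteTopology Λ] [IsZLattice ℝ Λ]
        (K : ConvexBody (EuclideanSpace ℝ (Fin d))),
        (∀ x ∈ K, -x ∈ K) →
        (interior (K : Set (EuclideanSpace ℝ (Fin d)))).Nonempty →
        (successiveMinimum Λ K d ≤ 1 →
          ∃ 𝒜 : Finset (AffineSubspace ℝ (EuclideanSpace ℝ (Fin d))),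
            IsAffineCover k (𝒜 : Set (AffineSubspace ℝ (EuclideanSpace ℝ (Fin d))))
              ((Λ : Set (EuclideanSpace ℝ (Fin d))) ∩ K) ∧
            (𝒜.card : ℝ) ≤ C * (∏ i ∈ Finset.Icc (k + 1) d, successiveMinimum Λ K i)⁻¹) ∧
        (∀ 𝒜 : Finset (AffineSubspace ℝ (EuclideanSpace ℝ (Fin d))),
          IsAffineCover k (𝒜 : Set (AffineSubspace ℝ (EuclideanSpace ℝ (Fin d))))
            ((Λ : Set (EuclideanSpace ℝ (Fin d))) ∩ K) →
          c * (∏ i ∈ Finset.Icc (k + 1) d, successiveMinimum Λ K i)⁻¹ ≤ (𝒜.card : ℝ)) := by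
  have hd : (0 : ℝ) < d := by exact_mod_cast (Nat.zero_le k).trans_lt hkd
  refine ⟨(2 * d * (2 * (2 * d) ^ d * (1 + 2 * (2 * d) ^ d) ^ d) + 2) ^ d, (1 / d) ^ d,
    by positivity, by positivity, fun Λ _ _ K hsymm hint => ?_⟩
  obtain ⟨N, hN, hNK⟩ := K.exists_seminorm hsymm hint
  have hNK1 : ∀ x, x ∈ (K : Set (EuclideanSpace ℝ (Fin d))) ↔ N x ≤ 1 := fun x => by
    rw [← hNK 1 zero_le_one, one_smul]
  have hfin : ∀ t : ℝ, {x | x ∈ Λ ∧ N x ≤ t}.Finite := by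
    intro t
    have hclosed : IsClosed (Λ : Set (EuclideanSpace ℝ (Fin d))) :=
      @AddSubgroup.isClosed_of_discrete _ _ _ _ _ Λ.toAddSubgroup ‹_›
    -- For negative `t` the ball is empty, and dilates describe only balls of non-negative radius.
    refine (Metric.finite_isBounded_inter_isClosed (s := (Λ : Set (EuclideanSpace ℝ (Fin d))))
      DiscreteTopology.isDiscrete (K.isCompact.smul (max t 0)).isBounded hclosed).subset ?_
    rintro x ⟨hx, hxt⟩
    exact ⟨(hNK _ (le_max_right _ _) x).2 (hxt.trans (le_max_left _ _)), hx⟩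
  obtain ⟨b, hb⟩ := exists_isGreedyBasis Λ N hN hfin (IsZLattice.span_top (K := ℝ))
    (finrank_euclideanSpace_fin (𝕜 := ℝ) (n := d))
  have hprod : (∏ i ∈ Icc (k + 1) d, successiveMinimum Λ K i)⁻¹ =
      ∏ i with k ≤ i.val, (N (b i))⁻¹ := by
    rw [← prod_filter_le_inv_eq_inv_prod_Icc]
    exact prod_congr rfl fun i _ => by rw [successiveMinimum_eq hNK hb]
  rw [hprod]
  constructor
  · intro hle
    have hle1 : ∀ i, N (b i) ≤ 1 := by
      intro i
      have hlast := successiveMinimum_eq hNK hb ⟨d - 1, by omega⟩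
      rw [show d - 1 + 1 = d by omega] at hlast
      refine le_trans (hb.monotone ?_) (hlast.symm.trans_le hle)
      exact Nat.le_sub_one_of_lt i.2
    obtain ⟨𝒜, h1, h2, h3⟩ := hb.exists_cover hkd hle1 (hfin 1).toFinset
      (fun x hx => by simpa using hx)
    exact ⟨𝒜, ⟨h1, fun x hx => h2 x (by simpa using ⟨hx.1, (hNK1 x).1 hx.2⟩)⟩, h3⟩
  · rintro 𝒜 ⟨h1, h2⟩
    exact hb.le_card_cover hkd 𝒜 (fun A hA => (h1 A hA).2)
      fun x hx hx1 => h2 x ⟨hx, (hNK1 x).2 hx1⟩
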